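/- **Model.** A test gateway sits at the origin of the plane. Let $\Delta x,\Delta y,R,P>0$, $\eta>2$, noise power $\sigma^2\ge 0$, $\mathcal N_G\in\mathbb N$ with $\mathcal N_G\ge 1$, and let $G(\theta)=1+b\cos(n\theta)$ with $0\le b\le 1$ and $n\in\mathbb N$ be the gateway's antenna gain; all devices are omni-directional (gain $1$) and transmit with constant power $P$. The intended device is at a point $v_o\neq 0$ at distance $r_o=\|v_o\|$ and the gateway's antenna points at it. In the 2-D PPP approximation the device locations form a homogeneous Poisson point process $\Psi=\{v_i\}$ on $\mathbb R^2$ of intensity $\frac{1}{\Delta x\,\Delta y\,\mathcal N_G}$, and those with $\|v_i\|\ge\frac{\sqrt3R}{2}$ interfere. The fading gains $h_o,h_1,h_2,\dots$ are i.i.d. exponential with mean $1$ and independent of $\Psi$. With $\theta_i$ the angle between $v_i$ and $v_o$, and $g_o$ the receive gain of the intended link, put $$\mathrm{SINR}=\frac{P\,h_o\,g_o\,r_o^{-\eta}}{\sigma^2+\sum_{i:\ \|v_i\|\ge \sqrt3R/2}P\,h_i\,G(\theta_i)\,\|v_i\|^{-\eta}},\qquad p_m=\mathbb P\{\mathrm{SINR}>\Xi_m\},\qquad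 \Xi_m=2^{\frac{L}{m\zeta WT_s}}-1,$$ where $L,W,T_s>0$, $0<\zeta\le1$ and $m\ge 1$ is an integer. Below, ${}_2F_1(a,b;c;\cdot)$ is the Gauss hypergeometric function, analytically continued to $(-\infty,1)$. **Corollary 3.** If the intended link has the aligned gain $g_o=2$ (the value of $G(0)$ for $b=1$), then $$p_m=\exp\left\{-\frac{\Xi_m r_o^{\eta}\sigma^2}{2P}-\int_0^{2\pi}\frac{\Xi_m r_o^{\eta}\,G(\theta)\left(\frac{\sqrt3R}{2}\right)^{2-\eta}}{2\,\Delta x\,\Delta y\,\mathcal N_G(\eta-2)}\;{}_2F_1\!\left(1,1-\frac2\eta;2-\frac2\eta;\frac{-\Xi_m r_o^{\eta}G(\theta)}{2\left(\frac{\sqrt3R}{2}\right)^{\eta}}\right)d\theta\right\}.$$ If instead $g_o=G(0)=1+b$, the same formula holds with each of the three factors $2$ in the denominators $2P$, $2\,\Delta x\,\Delta y\,\mathcal N_G(\eta-2)$ and $2\left(\frac{\sqrt3R}{2}\right)^{\eta}$ replaced by $1+b$. -/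

import Mathlib

open MeasureTheory ProbabilityTheory Set
open scoped ENNReal NNReal

noncomputable section

namespace IoTNetwork

/-! ### The Gauss hypergeometric function on the real half-line `(-∞, 1)` -/

/-- `F` is the analytic continuation to `(-∞, 1)` of the Gauss hypergeometric series with real
parameters `a`, `b`, `c`.  (Mathlib's `ordinaryHypergeometric` is only the sum of the power series,
with a junk value for arguments outside its disc of convergence.) -/
def IsGaussHypergeometric (a b c : ℝ) (F : ℝ → ℝ) : Prop :=
  AnalyticOnNhd ℝ F (Iio 1) ∧ ∀ x : ℝ, |x| < 1 → F x = ordinaryHypergeometric a b c x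

/-- The continuation is unique on `(-∞, 1)`. -/
theorem IsGaussHypergeometric.eqOn {a b c : ℝ} {F F' : ℝ → ℝ}
    (hF : IsGaussHypergeometric a b c F) (hF' : IsGaussHypergeometric a b c F') :
    EqOn F F' (Iio 1) := by
  refine hF.1.eqOn_of_preconnected_of_eventuallyEq hF'.1 isPreconnected_Iio
    (z₀ := 0) (by simp) ?_
  filter_upwards [Ioo_mem_nhds (show (-1 : ℝ) < 0 by norm_num) (show (0 : ℝ) < 1 by norm_num)]
    with x hx
  rw [hF.2 x (abs_lt.2 hx), hF'.2 x (abs_lt.2 hx)]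

open Classical in
/-- The Gauss hypergeometric function `₂F₁(a, b; c; x)` for real `x < 1`. -/
def gauss2F1 (a b c x : ℝ) : ℝ :=
  if h : ∃ F : ℝ → ℝ, IsGaussHypergeometric a b c F then h.choose x else 0

theorem gaussCoefficient_eq {b : ℝ} (hb : 0 < b) (n : ℕ) :
    ((n.factorial : ℝ)⁻¹ * (ascPochhammer ℝ n).eval 1 * (ascPochhammer ℝ n).eval b *
      ((ascPochhammer ℝ n).eval (b + 1))⁻¹) = b / (b + n) := by
  have h1 : (ascPochhammer ℝ n).eval (1 : ℝ) = n.factorial := by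
    simp
  have h2 : (ascPochhammer ℝ n).eval b * (b + n) = b * (ascPochhammer ℝ n).eval (b + 1) := by
    rw [← ascPochhammer_succ_eval, ascPochhammer_succ_left]
    simp [Polynomial.eval_comp]
  have h3 : 0 < (ascPochhammer ℝ n).eval (b + 1) := ascPochhammer_pos n _ (by linarith)
  have h4 : (n.factorial : ℝ) ≠ 0 := by positivity
  have h5 : 0 < b + n := by positivity
  rw [h1]
  field_simp
  linarith

/-- The continuation exists for the parameters `1`, `b`, `b + 1` with `b > 0`; it is given by Euler's
integral. -/
theorem exists_isGaussHypergeometric {b : ℝ} (hb : 0 < b) :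
    ∃ F : ℝ → ℝ, IsGaussHypergeometric 1 b (b + 1) F := by
  let g : ℂ → ℂ := fun z => ∫ t in Ioc (0 : ℝ) 1, ((t ^ (b - 1) : ℝ) : ℂ) / (1 - z * t)
  have hint : IntegrableOn (fun t : ℝ => t ^ (b - 1)) (Ioc 0 1) :=
    (intervalIntegrable_iff_integrableOn_Ioc_of_le zero_le_one).1
      (intervalIntegral.intervalIntegrable_rpow' (by linarith))
  have hmeas : ∀ z : ℂ, AEStronglyMeasurable
      (fun t : ℝ => ((t ^ (b - 1) : ℝ) : ℂ) / (1 - z * t)) (volume.restrict (Ioc 0 1)) := by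
    intro z
    exact Measurable.aestronglyMeasurable (by fun_prop)
  have hden : ∀ {δ : ℝ} {z : ℂ} {t : ℝ}, δ ≤ 1 → δ ≤ 1 - z.re → t ∈ Ioc (0 : ℝ) 1 →
      δ ≤ ‖1 - z * t‖ := by
    intro δ z t h1 h2 ht
    refine le_trans ?_ (Complex.re_le_norm _)
    simp
    nlinarith [ht.1, ht.2]
  have hdiff : DifferentiableOn ℂ g {z | z.re < 1} := by
    intro z hz
    have hz : z.re < 1 := hz
    obtain ⟨δ, hδ, hδ1, hδz⟩ : ∃ δ : ℝ, 0 < δ ∧ δ ≤ 1 ∧ δ + δ ≤ 1 - z.re :=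
      ⟨min 1 ((1 - z.re) / 2), by simp; linarith, min_le_left _ _,
        by linarith [min_le_right 1 ((1 - z.re) / 2)]⟩
    have hball : ∀ w ∈ Metric.ball z δ, δ ≤ 1 - w.re := by
      intro w hw
      have := (Complex.abs_re_le_norm (w - z)).trans_lt (mem_ball_iff_norm.1 hw)
      rw [Complex.sub_re, abs_lt] at this
      linarith [this.2]
    have := (hasDerivAt_integral_of_dominated_loc_of_deriv_le (𝕜 := ℂ)
      (μ := volume.restrict (Ioc (0:ℝ) 1))
      (F := fun z t => ((t ^ (b - 1) : ℝ) : ℂ) / (1 - z * t))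
      (F' := fun z t => ((t ^ (b - 1) : ℝ) : ℂ) * t / (1 - z * t) ^ 2)
      (x₀ := z) (bound := fun t => t ^ (b - 1) / δ ^ 2) (Metric.ball_mem_nhds z hδ)
      (Filter.Eventually.of_forall hmeas) ?_ ?_ ?_ (hint.div_const _) ?_).2
    · exact this.differentiableAt.differentiableWithinAt
    · refine Integrable.mono' (hint.div_const δ) (hmeas z) ?_
      filter_upwards [ae_restrict_mem measurableSet_Ioc] with t ht
      rw [norm_div, Complex.norm_real, Real.norm_of_nonneg (Real.rpow_nonneg ht.1.le _)]
      exact div_le_div_of_nonneg_left (Real.rpow_nonneg ht.1.le _) hδ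
        (hden hδ1 (by linarith) ht)
    · exact Measurable.aestronglyMeasurable (by fun_prop)
    · filter_upwards [ae_restrict_mem measurableSet_Ioc] with t ht w hw
      rw [norm_div, norm_mul, norm_pow, Complex.norm_real, Complex.norm_real,
        Real.norm_of_nonneg (Real.rpow_nonneg ht.1.le _), Real.norm_of_nonneg ht.1.le]
      have h1 := hden hδ1 (hball w hw) ht
      have h2 := Real.rpow_nonneg ht.1.le (b - 1)
      refine div_le_div₀ h2 ?_ (by positivity) (by gcongr)
      nlinarith [ht.2]
    · filter_upwards [ae_restrict_mem measurableSet_Ioc] with t ht w hw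
      have h1 := hden hδ1 (hball w hw) ht
      have h2 : (1 - w * t) ≠ 0 := norm_pos_iff.1 (hδ.trans_le h1)
      have h3 : HasDerivAt (fun w : ℂ => 1 - w * t) (-(1 * (t : ℂ))) w :=
        ((hasDerivAt_id w).mul_const _).const_sub 1
      refine ((hasDerivAt_const w ((t ^ (b - 1) : ℝ) : ℂ)).div h3 h2).congr_deriv ?_
      ring
  have hopen : IsOpen {z : ℂ | z.re < 1} := isOpen_lt Complex.continuous_re continuous_const
  have han := (hdiff.analyticOnNhd hopen)
  have hreal : ∀ x : ℝ, (b * (g x).re) =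
      b * ∫ t in Ioc (0:ℝ) 1, t ^ (b - 1) / (1 - x * t) := by
    intro x
    have : g x = ((∫ t in Ioc (0:ℝ) 1, t ^ (b - 1) / (1 - x * t) : ℝ) : ℂ) := by
      rw [← integral_complex_ofReal]
      simp [g]
    rw [this, Complex.ofReal_re]
  refine ⟨fun x => b * (g x).re, ?_, ?_⟩
  · intro x hx
    have h1 : AnalyticAt ℝ g (x : ℂ) := (han x (by simpa using hx)).restrictScalars
    have h2 : AnalyticAt ℝ (fun x : ℝ => g x) x :=
      AnalyticAt.fun_comp (f := fun x : ℝ => (x : ℂ)) h1 (Complex.ofRealCLM.analyticAt x)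
    exact analyticAt_const.mul ((Complex.reCLM.analyticAt _).comp h2)
  · intro x hx
    show b * (g x).re = _
    rw [hreal, ordinaryHypergeometric_eq_tsum]
    simp only [gaussCoefficient_eq hb, smul_eq_mul]
    have hI : ∀ n : ℕ, ∫ t in Ioc (0:ℝ) 1, t ^ (b - 1) * (x * t) ^ n = x ^ n / (b + n) := by
      intro n
      have : ∀ t ∈ Ioc (0:ℝ) 1, t ^ (b - 1) * (x * t) ^ n = x ^ n * t ^ (b - 1 + n) := by
        intro t ht
        rw [Real.rpow_add_natCast ht.1.ne', mul_pow]; ring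
      rw [setIntegral_congr_fun measurableSet_Ioc this, integral_const_mul,
        ← intervalIntegral.integral_of_le zero_le_one,
        integral_rpow (Or.inl (by have : (0:ℝ) ≤ n := by positivity
                                  linarith))]
      have : (0:ℝ) < b + n := by positivity
      have h0 : b - 1 + n + 1 = b + n := by ring
      rw [h0, Real.one_rpow, Real.zero_rpow this.ne']
      ring
    have hs := hasSum_integral_of_dominated_convergence (μ := volume.restrict (Ioc (0:ℝ) 1))
      (F := fun (n : ℕ) t => t ^ (b - 1) * (x * t) ^ n)
      (f := fun t => t ^ (b - 1) / (1 - x * t))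
      (fun n t => t ^ (b - 1) * |x| ^ n) ?_ ?_ ?_ ?_ ?_
    · simp only [hI] at hs
      rw [← hs.tsum_eq, ← tsum_mul_left]
      congr 1
      ext n
      ring
    · intro n
      exact Measurable.aestronglyMeasurable (by fun_prop)
    · intro n
      filter_upwards [ae_restrict_mem measurableSet_Ioc] with t ht
      rw [norm_mul, Real.norm_of_nonneg (Real.rpow_nonneg ht.1.le _), norm_pow, Real.norm_eq_abs,
        abs_mul, abs_of_pos ht.1]
      refine mul_le_mul_of_nonneg_left ?_ (Real.rpow_nonneg ht.1.le (b - 1))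
      exact pow_le_pow_left₀ (mul_nonneg (abs_nonneg x) ht.1.le)
        (mul_le_of_le_one_right (abs_nonneg x) ht.2) n
    · exact Filter.Eventually.of_forall fun t =>
        (summable_geometric_of_lt_one (abs_nonneg x) hx).mul_left _
    · simp only [tsum_mul_left]
      exact hint.mul_const _
    · filter_upwards [ae_restrict_mem measurableSet_Ioc] with t ht
      rw [div_eq_mul_inv]
      refine (hasSum_geometric_of_abs_lt_one ?_).mul_left _
      rw [abs_mul, abs_of_pos ht.1]
      nlinarith [ht.2, abs_nonneg x]

/-- For these parameters `gauss2F1` is the analytic continuation of the Gauss series. -/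
theorem isGaussHypergeometric_gauss2F1 {b : ℝ} (hb : 0 < b) :
    IsGaussHypergeometric 1 b (b + 1) (gauss2F1 1 b (b + 1)) := by
  have h := exists_isGaussHypergeometric hb
  have heq : gauss2F1 1 b (b + 1) = h.choose := by
    funext x
    simp [gauss2F1, h]
  rw [heq]
  exact h.choose_spec

/-! ### Poisson point processes -/

/-- The number of points of the sequence `X` that lie in `A`. -/
def pointCount {Ω E : Type*} (X : ℕ → Ω → E) (A : Set E) (ω : Ω) : ℝ≥0∞ :=
  ∑' i, A.indicator (fun _ => 1) (X i ω)

/-- The random points `X 0, X 1, X 2, …` are an enumeration of a Poisson point process on `E` with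
intensity measure `Λ` of infinite total mass: the number of points in a measurable set `A` of finite
intensity is Poisson distributed with mean `Λ A`, and the numbers of points in disjoint measurable
sets are independent. -/
structure IsPoissonPointProcess {Ω E : Type*} [MeasurableSpace Ω] [MeasurableSpace E]
    (X : ℕ → Ω → E) (Λ : Measure E) (μ : Measure Ω) : Prop where
  measurable : ∀ i, Measurable (X i)
  hasLaw_count : ∀ A : Set E, MeasurableSet A → Λ A ≠ ∞ →
    HasLaw (pointCount X A) ((poissonMeasure (Λ A).toNNReal).map (fun k : ℕ => (k : ℝ≥0∞))) μ
  indep_count : ∀ (k : ℕ) (A : Fin k → Set E), (∀ j, MeasurableSet (A j)) →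
    Pairwise (fun i j => Disjoint (A i) (A j)) →
    iIndepFun (fun j => pointCount X (A j)) μ

/-! ### The network -/

/-- The antenna gain `G(θ) = 1 + b cos(nθ)`. -/
def antennaGain (b : ℝ) (n : ℕ) (θ : ℝ) : ℝ := 1 + b * Real.cos (n * θ)

/-- The decoding threshold `Ξ_m = 2^{L/(m ζ W T_s)} - 1`, i.e. the solution of
`L/(m T_s) = ζ W log₂(1 + Ξ_m)`. -/
def sinrThreshold (L ζ W Ts : ℝ) (m : ℕ) : ℝ := (2 : ℝ) ^ (L / (m * ζ * W * Ts)) - 1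

/-- Intensity `1/(Δx Δy N_G)` (active devices per unit area). -/
def activeDensity (Δx Δy : ℝ) (NG : ℕ) : ℝ := 1 / (Δx * Δy * NG)

/-- The random elements of the 2-D PPP model, the plane being `ℂ` and the test gateway its origin:
`X` enumerates the locations of a homogeneous Poisson point process of intensity `lam` on the plane,
`h₀` is the fading gain of the intended link and `h i` that of the link from `X i` to the test
gateway.  All fading gains are i.i.d. exponential with mean one, and independent of the locations. -/
structure PPPModel {Ω : Type*} [MeasurableSpace Ω] (μ : Measure Ω) (lam : ℝ)
    (X : ℕ → Ω → ℂ) (h₀ : Ω → ℝ) (h : ℕ → Ω → ℝ) : Prop where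
  poisson : IsPoissonPointProcess X (ENNReal.ofReal lam • (volume : Measure ℂ)) μ
  law_h₀ : HasLaw h₀ (expMeasure 1) μ
  law_h : ∀ i, HasLaw (h i) (expMeasure 1) μ
  indep_gains : iIndepFun (fun i : Option ℕ => i.elim h₀ h) μ
  indep_locations : IndepFun (fun ω (i : ℕ) => X i ω) (fun ω (i : Option ℕ) => i.elim h₀ h ω) μ

/-- Aggregate interference at the origin, for constant transmission power `P`, path-loss exponent
`η` and fading gains `h i`, when an interferer at `v` has transmit antenna gain `GT v` and receive
antenna gain `GR v`.  Devices closer than `√3 R / 2` to the test gateway do not interfere. -/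
def interference {Ω : Type*} (P η R : ℝ) (GT GR : ℂ → ℝ) (X : ℕ → Ω → ℂ) (h : ℕ → Ω → ℝ) (ω : Ω) :
    ℝ≥0∞ :=
  ∑' i, {v : ℂ | √3 * R / 2 ≤ ‖v‖}.indicator
    (fun v => ENNReal.ofReal (P * h i ω * GT v * GR v * ‖v‖ ^ (-η))) (X i ω)

/-- The SINR at the origin: `P h₀ g₀ r₀^{-η}` over noise power `σ²` plus interference, where `g₀` is
the product of the antenna gains of the intended link, of length `r₀`. -/
def sinr {Ω : Type*} (P η R σ r₀ g₀ : ℝ) (GT GR : ℂ → ℝ)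
    (X : ℕ → Ω → ℂ) (h₀ : Ω → ℝ) (h : ℕ → Ω → ℝ) (ω : Ω) : ℝ≥0∞ :=
  ENNReal.ofReal (P * h₀ ω * g₀ * r₀ ^ (-η)) /
    (ENNReal.ofReal (σ ^ 2) + interference P η R GT GR X h ω)

/-- The success probability `ℙ(SINR > Ξ)` with a directional gateway and omni-directional devices.
The gateway's antenna points at the intended device, located at `v₀`, so that a signal arriving from
`v` is received with the gain `G(θ)` where `θ` is the angle between `v` and `v₀`; all transmit gains
are one.  `g₀` is the receive gain of the intended link. -/
def successProb {Ω : Type*} [MeasurableSpace Ω] (μ : Measure Ω) (G : ℝ → ℝ)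
    (P η R σ g₀ Ξ : ℝ) (v₀ : ℂ) (X : ℕ → Ω → ℂ) (h₀ : Ω → ℝ) (h : ℕ → Ω → ℝ) : ℝ :=
  μ.real {ω | ENNReal.ofReal Ξ <
    sinr P η R σ ‖v₀‖ (1 * g₀) (fun _ => 1) (fun v => G (Complex.arg (v / v₀))) X h₀ h ω}

end IoTNetwork

end

open IoTNetwork

/-!
Since `ℙ(h₀ > x) = exp (-x)`, the event `SINR > Ξ` has as its probability the Laplace transform of
noise plus interference, rescaled by the path gain of the intended link. Given the locations, an
interferer of rescaled path gain `c` contributes the factor `1 / (1 + c) = exp (-log (1 + c))`, and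
the Laplace functional of the Poisson process turns the product of these factors into
`exp (-lam * ∫ c / (1 + c))`. In polar coordinates the radial integral has an explicit
antiderivative, because `F = ₂F₁(1, b; b + 1; ·)` with `b = 1 - 2 / η` solves
`x * F' x + b * F x = b / (1 - x)`.
-/

namespace IoTNetwork

open Filter Topology

noncomputable section

/-! ### Laplace transforms of `[0, ∞]`-valued random variables -/

/-- The function `x ↦ exp (-x)` on `[0, ∞]`. Taking Laplace transforms with it, sums that may
diverge need no summability hypotheses. -/
def expNeg (x : ℝ≥0∞) : ℝ≥0∞ := EReal.exp (-(x : EReal))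

theorem expNeg_ofReal {r : ℝ} (hr : 0 ≤ r) :
    expNeg (ENNReal.ofReal r) = ENNReal.ofReal (Real.exp (-r)) := by
  rw [expNeg, EReal.coe_ennreal_ofReal, max_eq_left hr, ← EReal.coe_neg, EReal.exp_coe]

@[simp] theorem expNeg_zero : expNeg 0 = 1 := by simp [expNeg]

@[simp] theorem expNeg_top : expNeg ∞ = 0 := by simp [expNeg]

theorem expNeg_add (x y : ℝ≥0∞) : expNeg (x + y) = expNeg x * expNeg y := by
  rw [expNeg, EReal.coe_ennreal_add, EReal.neg_add (.inl (EReal.coe_ennreal_ne_bot _))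
    (.inr (EReal.coe_ennreal_ne_bot _)), sub_eq_add_neg, EReal.exp_add, expNeg, expNeg]

theorem expNeg_sum {ι : Type*} (s : Finset ι) (f : ι → ℝ≥0∞) :
    expNeg (∑ i ∈ s, f i) = ∏ i ∈ s, expNeg (f i) := by
  classical
  induction s using Finset.induction_on with
  | empty => simp
  | insert a s ha ih => rw [Finset.sum_insert ha, Finset.prod_insert ha, expNeg_add, ih]

theorem expNeg_nat_mul (k : ℕ) (x : ℝ≥0∞) : expNeg (k * x) = expNeg x ^ k := by
  simpa using expNeg_sum (Finset.range k) fun _ => x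

@[fun_prop]
theorem continuous_expNeg : Continuous expNeg :=
  EReal.expOrderIso.continuous.comp (continuous_neg.comp continuous_coe_ennreal_ereal)

@[fun_prop]
theorem measurable_expNeg : Measurable expNeg := continuous_expNeg.measurable

theorem antitone_expNeg : Antitone expNeg := fun _ _ h =>
  EReal.exp_monotone (EReal.neg_le_neg_iff.2 (EReal.coe_ennreal_le_coe_ennreal_iff.2 h))

theorem expNeg_le_one (x : ℝ≥0∞) : expNeg x ≤ 1 := by
  simpa using antitone_expNeg (zero_le (a := x))

theorem lintegral_expNeg_const_add {α : Type*} [MeasurableSpace α] {μ : Measure α}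
    (K : ℝ≥0∞) {f : α → ℝ≥0∞} (hf : Measurable f) :
    ∫⁻ a, expNeg (K + f a) ∂μ = expNeg K * ∫⁻ a, expNeg (f a) ∂μ := by
  simp_rw [expNeg_add]
  exact lintegral_const_mul _ (measurable_expNeg.comp hf)

theorem tendsto_lintegral_expNeg {α ι : Type*} [MeasurableSpace α] {μ : Measure α}
    [IsFiniteMeasure μ] {l : Filter ι} [l.IsCountablyGenerated] {f : ι → α → ℝ≥0∞} {g : α → ℝ≥0∞}
    (hf : ∀ i, Measurable (f i)) (hfg : ∀ a, Tendsto (fun i => f i a) l (𝓝 (g a))) :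
    Tendsto (fun i => ∫⁻ a, expNeg (f i a) ∂μ) l (𝓝 (∫⁻ a, expNeg (g a) ∂μ)) :=
  tendsto_lintegral_filter_of_dominated_convergence (fun _ => 1)
    (.of_forall fun i => measurable_expNeg.comp (hf i))
    (.of_forall fun _ => .of_forall fun _ => expNeg_le_one _) (by simp)
    (.of_forall fun a => (continuous_expNeg.tendsto _).comp (hfg a))

theorem lintegral_expNeg_tsum_of_iIndepFun {Ω ι : Type*} [Countable ι] [MeasurableSpace Ω]
    {μ : Measure Ω} {Z : ι → Ω → ℝ≥0∞} (hZ : ∀ i, Measurable (Z i)) (hind : iIndepFun Z μ)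
    {a : ι → ℝ≥0∞} (ha : ∀ i, ∫⁻ ω, expNeg (Z i ω) ∂μ = expNeg (a i)) :
    ∫⁻ ω, expNeg (∑' i, Z i ω) ∂μ = expNeg (∑' i, a i) := by
  have := hind.isProbabilityMeasure
  have hfinite : ∀ s : Finset ι, ∫⁻ ω, expNeg (∑ i ∈ s, Z i ω) ∂μ = expNeg (∑ i ∈ s, a i) := by
    intro s
    simp_rw [expNeg_sum, ← ha]
    exact lintegral_prod_eq_prod_lintegral_of_indepFun s _
      (hind.comp (fun _ => expNeg) fun _ => measurable_expNeg)
      fun i => measurable_expNeg.comp (hZ i)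
  have hlim := tendsto_lintegral_expNeg (μ := μ)
    (fun s : Finset ι => Finset.measurable_fun_sum s fun i _ => hZ i)
    fun ω => (ENNReal.summable (f := fun i => Z i ω)).hasSum
  simp_rw [hfinite] at hlim
  exact tendsto_nhds_unique hlim ((continuous_expNeg.tendsto _).comp ENNReal.summable.hasSum)

/-! ### The Laplace functional of a Poisson point process -/

theorem lintegral_pow_poissonMeasure (r : ℝ≥0) {y : ℝ≥0∞} (hy : y ≤ 1) :
    ∫⁻ k, y ^ k ∂(poissonMeasure r) = expNeg (r * (1 - y)) := by
  lift y to ℝ≥0 using ne_top_of_le_ne_top ENNReal.one_ne_top hy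
  have hy : y ≤ 1 := by exact_mod_cast hy
  have hexponent : (r : ℝ≥0∞) * (1 - y) = ENNReal.ofReal (r * (1 - y)) := by
    rw [ENNReal.ofReal_mul r.coe_nonneg, ENNReal.ofReal_sub _ y.coe_nonneg]
    simp
  have hseries : HasSum (fun k : ℕ => Real.exp (-r) * r ^ k / k.factorial * y ^ k)
      (Real.exp (-(r * (1 - y)))) := by
    have := (NormedSpace.expSeries_div_hasSum_exp (𝔸 := ℝ) (r * y : ℝ)).mul_left (Real.exp (-r))
    rw [← Real.exp_eq_exp_ℝ, ← Real.exp_add] at this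
    convert! this using 2 <;> ring
  rw [hexponent, expNeg_ofReal (mul_nonneg r.coe_nonneg (sub_nonneg.2 (by exact_mod_cast hy))),
    ← hseries.tsum_eq, ENNReal.ofReal_tsum_of_nonneg (fun k => by positivity) hseries.summable,
    poissonMeasure, lintegral_sum_measure]
  refine tsum_congr fun k => ?_
  rw [lintegral_smul_measure, lintegral_dirac, smul_eq_mul, ENNReal.ofReal_mul (by positivity)]
  simp

theorem exists_monotone_simpleFunc_finMeasSupp_tendsto {E : Type*} [MeasurableSpace E]
    (Λ : Measure E) [SigmaFinite Λ] {φ : E → ℝ≥0∞} (hφ : Measurable φ) :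
    ∃ ψ : ℕ → SimpleFunc E ℝ≥0∞, (∀ k, (ψ k).FinMeasSupp Λ) ∧
      (∀ v, Monotone fun k => ψ k v) ∧ ∀ v, Tendsto (fun k => ψ k v) atTop (𝓝 (φ v)) := by
  have happly : ∀ k v, (SimpleFunc.eapprox φ k).restrict (spanningSets Λ k) v =
      (spanningSets Λ k).indicator (SimpleFunc.eapprox φ k) v := fun k v => by
    rw [SimpleFunc.restrict_apply _ (measurableSet_spanningSets Λ k)]
  refine ⟨fun k => (SimpleFunc.eapprox φ k).restrict (spanningSets Λ k), fun k => ?_,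
    fun v k l hkl => ?_, fun v => ?_⟩
  · refine SimpleFunc.finMeasSupp_iff_support.2
      ((measure_mono fun v hv => ?_).trans_lt (measure_spanningSets_lt_top Λ k))
    rw [Function.mem_support, happly] at hv
    exact mem_of_indicator_ne_zero hv
  · simp only [happly]
    exact (indicator_le_indicator_of_subset (monotone_spanningSets Λ hkl)
      (fun _ => zero_le) v).trans (indicator_le_indicator (SimpleFunc.monotone_eapprox φ hkl v))
  · refine (SimpleFunc.tendsto_eapprox hφ v).congr' ?_
    filter_upwards [eventually_ge_atTop (spanningSetsIndex Λ v)] with k hk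
    rw [happly, indicator_of_mem (monotone_spanningSets Λ hk (mem_spanningSetsIndex Λ v))]

theorem tsum_simpleFunc_eq_sum_pointCount_mul {Ω E : Type*} [MeasurableSpace E]
    (X : ℕ → Ω → E) (ψ : SimpleFunc E ℝ≥0∞) (ω : Ω) :
    ∑' i, ψ (X i ω) = ∑ a ∈ ψ.range.filter (· ≠ 0), pointCount X (ψ ⁻¹' {a}) ω * a := by
  simp_rw [pointCount, ← ENNReal.tsum_mul_right]
  rw [← Summable.tsum_finsetSum fun _ _ => ENNReal.summable]
  refine tsum_congr fun i => ?_
  rw [Finset.sum_filter_of_ne (by rintro a - h rfl; simp at h),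
    Finset.sum_eq_single_of_mem _ (ψ.mem_range_self (X i ω)) fun a _ ha => by simp [Ne.symm ha]]
  simp

section PoissonPointProcess

variable {Ω E : Type*} [MeasurableSpace Ω] [MeasurableSpace E] {μ : Measure Ω}
  {X : ℕ → Ω → E} {Λ : Measure E}

theorem measurable_tsum_comp (hX : ∀ i, Measurable (X i)) {φ : E → ℝ≥0∞} (hφ : Measurable φ) :
    Measurable fun ω => ∑' i, φ (X i ω) :=
  Measurable.tsum fun i => hφ.comp (hX i)

theorem measurable_pointCount (hX : ∀ i, Measurable (X i)) {A : Set E} (hA : MeasurableSet A) :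
    Measurable (pointCount X A) :=
  measurable_tsum_comp hX (measurable_const.indicator hA)

theorem IsPoissonPointProcess.lintegral_expNeg_pointCount_mul (hX : IsPoissonPointProcess X Λ μ)
    {A : Set E} (hA : MeasurableSet A) (hΛ : Λ A ≠ ∞) (a : ℝ≥0∞) :
    ∫⁻ ω, expNeg (pointCount X A ω * a) ∂μ = expNeg (Λ A * (1 - expNeg a)) := by
  have hlaw := hX.hasLaw_count A hA hΛ
  have hmeas : Measurable fun x : ℝ≥0∞ => expNeg (x * a) := by fun_prop
  rw [← lintegral_map' (f := fun x => expNeg (x * a)) hmeas.aemeasurable hlaw.aemeasurable,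
    hlaw.map_eq, lintegral_map hmeas (measurable_of_countable _)]
  simp_rw [expNeg_nat_mul]
  rw [lintegral_pow_poissonMeasure _ (expNeg_le_one a), ENNReal.coe_toNNReal hΛ]

theorem IsPoissonPointProcess.lintegral_expNeg_tsum_simpleFunc (hX : IsPoissonPointProcess X Λ μ)
    {ψ : SimpleFunc E ℝ≥0∞} (hψ : ψ.FinMeasSupp Λ) :
    ∫⁻ ω, expNeg (∑' i, ψ (X i ω)) ∂μ = expNeg (∫⁻ v, (1 - expNeg (ψ v)) ∂Λ) := by
  set s := ψ.range.filter (· ≠ 0)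
  let e := s.equivFin.symm
  have hdisj : Pairwise fun i j => Disjoint (ψ ⁻¹' {(e i : ℝ≥0∞)}) (ψ ⁻¹' {(e j : ℝ≥0∞)}) :=
    fun i j hij => .preimage _ <| disjoint_singleton.2 fun h => hij <| e.injective <| Subtype.ext h
  have hind := (hX.indep_count s.card _ (fun j => ψ.measurableSet_fiber (e j)) hdisj).comp
    (fun j x => x * (e j : ℝ≥0∞)) fun j => by fun_prop
  have hcounts := lintegral_expNeg_tsum_of_iIndepFun
    (fun j => (measurable_pointCount hX.measurable (ψ.measurableSet_fiber (e j))).mul_const _) hind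
    fun j => hX.lintegral_expNeg_pointCount_mul (ψ.measurableSet_fiber (e j))
      (SimpleFunc.finMeasSupp_iff.1 hψ _ (Finset.mem_filter.1 (e j).2).2).ne (e j)
  have hreindex : ∀ f : ℝ≥0∞ → ℝ≥0∞, ∑' j, f (e j) = ∑ a ∈ s, f a := fun f => by
    rw [tsum_fintype, e.sum_comp fun a : s => f a, Finset.sum_coe_sort]
  have hintegral : ∫⁻ v, (1 - expNeg (ψ v)) ∂Λ = ∑ a ∈ s, Λ (ψ ⁻¹' {a}) * (1 - expNeg a) := by
    change ∫⁻ v, ψ.map (fun a => 1 - expNeg a) v ∂Λ = _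
    rw [SimpleFunc.lintegral_eq_lintegral, SimpleFunc.map_lintegral,
      Finset.sum_filter_of_ne (by rintro a - h rfl; simp at h)]
    simp_rw [mul_comm]
  rw [hintegral, ← hreindex, ← hcounts]
  refine lintegral_congr fun ω => ?_
  rw [tsum_simpleFunc_eq_sum_pointCount_mul, ← hreindex]

theorem IsPoissonPointProcess.lintegral_expNeg_tsum [IsFiniteMeasure μ] [SigmaFinite Λ]
    (hX : IsPoissonPointProcess X Λ μ) {φ : E → ℝ≥0∞} (hφ : Measurable φ) :
    ∫⁻ ω, expNeg (∑' i, φ (X i ω)) ∂μ = expNeg (∫⁻ v, (1 - expNeg (φ v)) ∂Λ) := by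
  obtain ⟨ψ, hsupp, hmono, hlim⟩ := exists_monotone_simpleFunc_finMeasSupp_tendsto Λ hφ
  have hsum : ∀ ω, Tendsto (fun k => ∑' i, ψ k (X i ω)) atTop (𝓝 (∑' i, φ (X i ω))) := by
    intro ω
    simp_rw [← lintegral_count]
    exact lintegral_tendsto_of_tendsto_of_monotone
      (fun k => (measurable_of_countable _).aemeasurable)
      (.of_forall fun i => hmono _) (.of_forall fun i => hlim _)
  have hleft := tendsto_lintegral_expNeg (μ := μ)
    (fun k => measurable_tsum_comp hX.measurable (ψ k).measurable) hsum
  have hright : Tendsto (fun k => ∫⁻ v, (1 - expNeg (ψ k v)) ∂Λ) atTop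
      (𝓝 (∫⁻ v, (1 - expNeg (φ v)) ∂Λ)) := by
    refine lintegral_tendsto_of_tendsto_of_monotone
      (fun k => ((measurable_expNeg.comp (ψ k).measurable).const_sub 1).aemeasurable)
      (.of_forall fun v k l hkl => tsub_le_tsub_left (antitone_expNeg (hmono v hkl)) 1)
      (.of_forall fun v => ?_)
    exact ENNReal.Tendsto.sub tendsto_const_nhds ((continuous_expNeg.tendsto _).comp (hlim v))
      (.inl ENNReal.one_ne_top)
  simp_rw [fun k => hX.lintegral_expNeg_tsum_simpleFunc (hsupp k)] at hleft
  exact tendsto_nhds_unique hleft ((continuous_expNeg.tendsto _).comp hright)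

end PoissonPointProcess

/-! ### Exponential fading -/

section ExponentialFading

theorem expMeasure_setOf_lt_ofReal {r : ℝ} (hr : 0 < r) (x : ℝ≥0∞) :
    expMeasure r {t | x < ENNReal.ofReal t} = expNeg (ENNReal.ofReal r * x) := by
  have := isProbabilityMeasure_expMeasure hr
  induction x with
  | top => simp [ENNReal.mul_top (ENNReal.ofReal_pos.2 hr).ne']
  | coe x =>
    have htail : {t : ℝ | (x : ℝ≥0∞) < ENNReal.ofReal t} = (Iic (x : ℝ))ᶜ := by
      ext t
      rw [mem_ofPred_eq, ← ENNReal.ofReal_coe_nnreal,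
        ENNReal.ofReal_lt_ofReal_iff_of_nonneg x.coe_nonneg, mem_compl_iff, mem_Iic, not_le]
    rw [htail, prob_compl_eq_one_sub measurableSet_Iic, ← ENNReal.ofReal_coe_nnreal,
      ← ENNReal.ofReal_mul hr.le, expNeg_ofReal (by positivity), ← ofReal_cdf,
      cdf_expMeasure_eq hr, if_pos x.coe_nonneg, ← ENNReal.ofReal_one, ← ENNReal.ofReal_sub]
    · simp
    · simpa using mul_nonneg hr.le x.coe_nonneg

theorem lintegral_expNeg_mul_expMeasure {r c : ℝ} (hr : 0 < r) (hc : 0 ≤ c) :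
    ∫⁻ t, expNeg (ENNReal.ofReal c * ENNReal.ofReal t) ∂(expMeasure r) =
      ENNReal.ofReal (r / (r + c)) := by
  have hpdf : ∀ r, Measurable (exponentialPDF r) := fun r =>
    (measurable_exponentialPDFReal r).ennreal_ofReal
  have htilt : ∀ t, exponentialPDF r t * expNeg (ENNReal.ofReal c * ENNReal.ofReal t) =
      ENNReal.ofReal (r / (r + c)) * exponentialPDF (r + c) t := by
    intro t
    rcases lt_or_ge t 0 with ht | ht
    · simp [exponentialPDF_of_neg ht]
    · rw [exponentialPDF_of_nonneg ht, exponentialPDF_of_nonneg ht, ← ENNReal.ofReal_mul hc,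
        expNeg_ofReal (by positivity), ← ENNReal.ofReal_mul (by positivity),
        ← ENNReal.ofReal_mul (by positivity), mul_assoc, ← Real.exp_add]
      congr 1
      field_simp
      ring_nf
  change ∫⁻ t, _ ∂(volume.withDensity (exponentialPDF r)) = _
  rw [lintegral_withDensity_eq_lintegral_mul _ (hpdf r) (by fun_prop)]
  simp only [Pi.mul_apply, htilt]
  rw [lintegral_const_mul _ (hpdf _), lintegral_exponentialPDF_eq_one (by positivity), mul_one]

theorem expNeg_ofReal_log_one_add {c : ℝ} (hc : 0 ≤ c) :
    expNeg (ENNReal.ofReal (Real.log (1 + c))) = ENNReal.ofReal (1 / (1 + c)) := by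
  rw [expNeg_ofReal (Real.log_nonneg (by linarith)), ← Real.log_inv, Real.exp_log (by positivity),
    one_div]

theorem one_sub_expNeg_ofReal_log_one_add {c : ℝ} (hc : 0 ≤ c) :
    1 - expNeg (ENNReal.ofReal (Real.log (1 + c))) = ENNReal.ofReal (c / (1 + c)) := by
  rw [expNeg_ofReal_log_one_add hc, ← ENNReal.ofReal_one, ← ENNReal.ofReal_sub _ (by positivity)]
  congr 1
  field_simp
  ring

variable {Ω : Type*} [MeasurableSpace Ω] {μ : Measure Ω}

theorem measure_prodMk_mem_of_indepFun {α β : Type*} [MeasurableSpace α] [MeasurableSpace β]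
    [IsFiniteMeasure μ] {U : Ω → α} {V : Ω → β} (hU : AEMeasurable U μ) (hV : AEMeasurable V μ)
    (hUV : IndepFun U V μ) {S : Set (α × β)} (hS : MeasurableSet S) :
    μ {ω | (U ω, V ω) ∈ S} = ∫⁻ ω, μ.map V {v | (U ω, v) ∈ S} ∂μ := by
  change μ ((fun ω => (U ω, V ω)) ⁻¹' S) = _
  rw [← Measure.map_apply_of_aemeasurable (hU.prodMk hV) hS, hUV.map_prod_eq_prod_map_map hU hV,
    Measure.prod_apply hS, lintegral_map' (measurable_measure_prodMk_left hS).aemeasurable hU]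
  rfl

theorem measure_lt_ofReal_of_hasLaw_expMeasure [IsFiniteMeasure μ] {r : ℝ} (hr : 0 < r)
    {Z : Ω → ℝ≥0∞} {g : Ω → ℝ} (hZ : AEMeasurable Z μ) (hg : HasLaw g (expMeasure r) μ)
    (hZg : IndepFun Z g μ) :
    μ {ω | Z ω < ENNReal.ofReal (g ω)} = ∫⁻ ω, expNeg (ENNReal.ofReal r * Z ω) ∂μ := by
  have hS : MeasurableSet {p : ℝ≥0∞ × ℝ | p.1 < ENNReal.ofReal p.2} :=
    measurableSet_lt (by fun_prop) (by fun_prop)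
  refine (measure_prodMk_mem_of_indepFun hZ hg.aemeasurable hZg hS).trans ?_
  simp only [hg.map_eq, mem_ofPred_eq, expMeasure_setOf_lt_ofReal hr]

section Gains

variable {ι : Type*} [Countable ι] {g : Option ι → Ω → ℝ}

theorem measurable_tsum_mul_ofReal {α : Type*} [MeasurableSpace α] {f : ι → α → ℝ}
    (hf : ∀ i, Measurable (f i)) (c : ι → ℝ≥0∞) :
    Measurable fun a => ∑' i, c i * ENNReal.ofReal (f i a) :=
  Measurable.tsum fun i => (hf i).ennreal_ofReal.const_mul (c i)

theorem indepFun_tsum_some_none (hg : ∀ i, Measurable (g i)) (hind : iIndepFun g μ)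
    (c : ι → ℝ≥0∞) :
    IndepFun (fun ω => ∑' i, c i * ENNReal.ofReal (g (some i) ω)) (g none) μ := by
  have hsup := indep_iSup_of_disjoint (fun i => (hg i).comap_le) hind.iIndep
    (S := {none}ᶜ) (T := {none}) disjoint_compl_left
  refine indep_of_indep_of_le_left (indep_of_indep_of_le_right hsup ?_) ?_
  · exact le_iSup₂_of_le none rfl le_rfl
  · rw [← measurable_iff_comap_le]
    refine @measurable_tsum_mul_ofReal ι _ Ω (_) _ (fun i => ?_) c
    exact (comap_measurable (g (some i))).mono (le_iSup₂_of_le (some i) (by simp) le_rfl) le_rfl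

theorem measure_add_tsum_mul_lt_of_iIndepFun (hg : ∀ i, Measurable (g i))
    (hlaw : ∀ i, HasLaw (g i) (expMeasure 1) μ) (hind : iIndepFun g μ) (K : ℝ≥0∞) {c : ι → ℝ}
    (hc : ∀ i, 0 ≤ c i) :
    μ {ω | K + ∑' i, ENNReal.ofReal (c i) * ENNReal.ofReal (g (some i) ω) <
        ENNReal.ofReal (g none ω)} =
      expNeg (K + ∑' i, ENNReal.ofReal (Real.log (1 + c i))) := by
  have := hind.isProbabilityMeasure
  have hsum := measurable_tsum_mul_ofReal (fun i => hg (some i)) fun i => ENNReal.ofReal (c i)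
  have hlaplace : ∀ i, ∫⁻ ω, expNeg (ENNReal.ofReal (c i) * ENNReal.ofReal (g (some i) ω)) ∂μ =
      expNeg (ENNReal.ofReal (Real.log (1 + c i))) := fun i => by
    rw [expNeg_ofReal_log_one_add (hc i), ← lintegral_expNeg_mul_expMeasure one_pos (hc i),
      ← (hlaw (some i)).map_eq, lintegral_map (by fun_prop) (hg (some i))]
  rw [measure_lt_ofReal_of_hasLaw_expMeasure one_pos
    (hsum.const_add K).aemeasurable (hlaw none)
    ((indepFun_tsum_some_none hg hind fun i => ENNReal.ofReal (c i)).comp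
      (measurable_const_add K) measurable_id)]
  simp_rw [ENNReal.ofReal_one, one_mul]
  rw [lintegral_expNeg_const_add K hsum, expNeg_add]
  congr 1
  have hterms := (hind.precomp (Option.some_injective ι)).comp
    (fun i t => ENNReal.ofReal (c i) * ENNReal.ofReal t) fun i => by fun_prop
  exact lintegral_expNeg_tsum_of_iIndepFun (fun i => (hg _).ennreal_ofReal.const_mul _)
    hterms hlaplace

end Gains

theorem IsPoissonPointProcess.measure_add_tsum_mul_lt {E : Type*} [MeasurableSpace E]
    {X : ℕ → Ω → E} {Λ : Measure E} [SigmaFinite Λ] (hX : IsPoissonPointProcess X Λ μ)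
    {g : Option ℕ → Ω → ℝ} (hlaw : ∀ i, HasLaw (g i) (expMeasure 1) μ) (hind : iIndepFun g μ)
    (hXg : IndepFun (fun ω i => X i ω) (fun ω i => g i ω) μ) (K : ℝ≥0∞) {c : E → ℝ}
    (hcm : Measurable c) (hc : ∀ v, 0 ≤ c v) :
    μ {ω | K + ∑' i, ENNReal.ofReal (c (X i ω)) * ENNReal.ofReal (g (some i) ω) <
        ENNReal.ofReal (g none ω)} =
      expNeg (K + ∫⁻ v, ENNReal.ofReal (c v / (1 + c v)) ∂Λ) := by
  have := hind.isProbabilityMeasure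
  have := isProbabilityMeasure_expMeasure one_pos
  have hgains : HasLaw (fun ω i => g i ω) (Measure.infinitePi fun _ => expMeasure 1) μ :=
    hind.hasLaw_infinitePi hlaw (aemeasurable_pi_iff.2 fun i => (hlaw i).aemeasurable)
  have hS : MeasurableSet {p : (ℕ → E) × (Option ℕ → ℝ) | K + ∑' i, ENNReal.ofReal (c (p.1 i)) *
      ENNReal.ofReal (p.2 (some i)) < ENNReal.ofReal (p.2 none)} :=
    measurableSet_lt ((Measurable.tsum fun i => by fun_prop).const_add K) (by fun_prop)
  have hcond : ∀ x : ℕ → E, (Measure.infinitePi fun _ => expMeasure 1) {y : Option ℕ → ℝ |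
      K + ∑' i, ENNReal.ofReal (c (x i)) * ENNReal.ofReal (y (some i)) < ENNReal.ofReal (y none)} =
      expNeg (K + ∑' i, ENNReal.ofReal (Real.log (1 + c (x i)))) := fun x =>
    measure_add_tsum_mul_lt_of_iIndepFun measurable_pi_apply
      (fun i => (measurePreserving_eval_infinitePi (fun _ : Option ℕ => expMeasure 1) i).hasLaw)
      (iIndepFun_infinitePi (X := fun _ y => y) fun _ => measurable_id) K fun i => hc (x i)
  have hlog : Measurable fun v => ENNReal.ofReal (Real.log (1 + c v)) := by fun_prop
  refine (measure_prodMk_mem_of_indepFun (measurable_pi_iff.2 hX.measurable).aemeasurable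
    hgains.aemeasurable hXg hS).trans ?_
  simp_rw [hgains.map_eq, mem_ofPred_eq, hcond]
  rw [lintegral_expNeg_const_add K (measurable_tsum_comp hX.measurable hlog),
    hX.lintegral_expNeg_tsum hlog, expNeg_add]
  simp_rw [one_sub_expNeg_ofReal_log_one_add (hc _)]

end ExponentialFading

/-! ### The radial integral -/

section RadialIntegral

theorem hasDerivAt_tsum_mul_pow {𝕜 : Type*} [RCLike 𝕜] {a : ℕ → 𝕜} {C : ℝ}
    (ha : ∀ n, ‖a n‖ ≤ C) {x : 𝕜} (hx : ‖x‖ < 1) :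
    HasDerivAt (fun y => ∑' n, a n * y ^ n) (∑' n, a n * (n * x ^ (n - 1))) x := by
  obtain ⟨r, hxr, hr⟩ := exists_between hx
  have hr0 : 0 < r := (norm_nonneg x).trans_lt hxr
  have hbound : Summable fun n : ℕ => C * (n * r ^ (n - 1)) := by
    refine Summable.mul_left C ?_
    have := (summable_pow_mul_geometric_of_norm_lt_one (R := ℝ) 1
      (by rwa [Real.norm_of_nonneg hr0.le] : ‖r‖ < 1)).mul_right r⁻¹
    refine this.congr fun n => ?_
    rcases n with _ | n
    · simp
    · simp only [Nat.add_sub_cancel, pow_succ]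
      field_simp
  refine hasDerivAt_tsum_of_isPreconnected hbound Metric.isOpen_ball
    (convex_ball (0 : 𝕜) r).isPreconnected (fun n y _ => (hasDerivAt_pow n y).const_mul (a n))
    (fun n y hy => ?_) (Metric.mem_ball_self hr0) ?_ (by simpa using hxr)
  · rw [norm_mul, norm_mul, norm_pow, RCLike.norm_natCast]
    have := (mem_ball_zero_iff.1 hy).le
    have := (norm_nonneg _).trans (ha n)
    gcongr
    exact ha n
  · exact summable_of_ne_finset_zero (s := {0}) fun n hn => by simp_all

variable {b : ℝ} {F : ℝ → ℝ}

theorem IsGaussHypergeometric.eq_tsum (hF : IsGaussHypergeometric 1 b (b + 1) F) (hb : 0 < b)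
    {x : ℝ} (hx : |x| < 1) : F x = ∑' n : ℕ, b / (b + n) * x ^ n := by
  rw [hF.2 x hx, ordinaryHypergeometric_eq_tsum]
  simp only [gaussCoefficient_eq hb, smul_eq_mul]

theorem IsGaussHypergeometric.mul_deriv_add_of_abs_lt_one
    (hF : IsGaussHypergeometric 1 b (b + 1) F) (hb : 0 < b) {x : ℝ} (hx : |x| < 1) :
    x * deriv F x + b * F x = b / (1 - x) := by
  have hcoeff (n : ℕ) : ‖b / (b + n)‖ ≤ 1 := by
    rw [Real.norm_of_nonneg (by positivity), div_le_one (by positivity)]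
    simp
  have hderiv : deriv F x = ∑' n : ℕ, b / (b + n) * (n * x ^ (n - 1)) := by
    refine ((hasDerivAt_tsum_mul_pow hcoeff hx).congr_of_eventuallyEq ?_).deriv
    filter_upwards [(isOpen_lt continuous_abs continuous_const).mem_nhds hx] with y hy
    exact hF.eq_tsum hb hy
  have hgeom : HasSum (fun n => b * x ^ n) (b / (1 - x)) :=
    (hasSum_geometric_of_abs_lt_one hx).mul_left b
  have hseries : Summable fun n : ℕ => b * (b / (b + n) * x ^ n) := by
    refine Summable.mul_left b (.of_norm_bounded
      (summable_geometric_of_lt_one (abs_nonneg x) hx) fun n => ?_)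
    rw [norm_mul, norm_pow, Real.norm_eq_abs x]
    exact mul_le_of_le_one_left (by positivity) (hcoeff n)
  rw [← eq_sub_iff_add_eq, hderiv, hF.eq_tsum hb hx, ← tsum_mul_left, ← tsum_mul_left,
    ← hgeom.tsum_eq, ← hgeom.summable.tsum_sub hseries]
  refine tsum_congr fun n => ?_
  have hn : b + n ≠ 0 := by positivity
  rcases n with _ | n
  · simp [hb.ne']
  · rw [Nat.add_sub_cancel, pow_succ]
    field_simp
    ring

theorem IsGaussHypergeometric.mul_deriv_add (hF : IsGaussHypergeometric 1 b (b + 1) F)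
    (hb : 0 < b) {x : ℝ} (hx : x < 1) : x * deriv F x + b * F x = b / (1 - x) := by
  have hleft : AnalyticOnNhd ℝ (fun y => y * deriv F y + b * F y) (Iio 1) :=
    (analyticOnNhd_id.mul hF.1.deriv).add (analyticOnNhd_const.mul hF.1)
  have hright : AnalyticOnNhd ℝ (fun y : ℝ => b / (1 - y)) (Iio 1) :=
    analyticOnNhd_const.div (analyticOnNhd_const.sub analyticOnNhd_id)
      fun y hy => (sub_pos.2 hy).ne'
  refine hleft.eqOn_of_preconnected_of_eventuallyEq hright isPreconnected_Iio
    (mem_Iio.2 one_pos) ?_ hx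
  filter_upwards [(isOpen_lt continuous_abs continuous_const).mem_nhds
    (show |(0 : ℝ)| < 1 by simp)] with y hy
  exact hF.mul_deriv_add_of_abs_lt_one hb hy

/-- The closed form of the radial integral `∫ r in d..∞, r * (c r ^ (-η) / (1 + c r ^ (-η)))`, which
is the contribution of one direction to the exponent of the success probability; `c` collects the
decoding threshold and all gains that do not depend on the distance. -/
def radialExponent (η c d : ℝ) : ℝ :=
  c * d ^ (2 - η) / (η - 2) * gauss2F1 1 (1 - 2 / η) (2 - 2 / η) (-c / d ^ η)

theorem one_sub_two_div_pos {η : ℝ} (hη : 2 < η) : 0 < 1 - 2 / η := by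
  rw [sub_pos, div_lt_one (by linarith)]
  exact hη

theorem isGaussHypergeometric_gauss2F1_of_two_lt {η : ℝ} (hη : 2 < η) :
    IsGaussHypergeometric 1 (1 - 2 / η) (1 - 2 / η + 1)
      (gauss2F1 1 (1 - 2 / η) (2 - 2 / η)) := by
  rw [show 2 - 2 / η = 1 - 2 / η + 1 by ring]
  exact isGaussHypergeometric_gauss2F1 (one_sub_two_div_pos hη)

theorem neg_div_rpow_lt_one {η c r : ℝ} (hc : 0 ≤ c) (hr : 0 < r) : -c / r ^ η < 1 :=
  (div_nonpos_of_nonpos_of_nonneg (neg_nonpos.2 hc) (by positivity)).trans_lt one_pos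

theorem hasDerivAt_radialExponent {η c r : ℝ} (hη : 2 < η) (hc : 0 ≤ c) (hr : 0 < r) :
    HasDerivAt (radialExponent η c) (-(r * (c * r ^ (-η) / (1 + c * r ^ (-η))))) r := by
  have hF := isGaussHypergeometric_gauss2F1_of_two_lt hη
  have hη2 : η - 2 ≠ 0 := by linarith
  have hz : -c / r ^ η < 1 := neg_div_rpow_lt_one hc hr
  have hprefactor : HasDerivAt (fun r => c * r ^ (2 - η) / (η - 2)) (-(c * r ^ (1 - η))) r := by
    convert! ((Real.hasDerivAt_rpow_const (p := 2 - η) (.inl hr.ne')).const_mul c).div_const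
      (η - 2) using 1
    rw [show 2 - η - 1 = 1 - η by ring]
    field_simp
    ring
  have hargument : HasDerivAt (fun r => -c / r ^ η) (-η * (-c / r ^ η) / r) r := by
    convert! (Real.hasDerivAt_rpow_const (p := η) (.inl hr.ne')).inv
      (by positivity : r ^ η ≠ 0) |>.const_mul (-c) using 1
    rw [Real.rpow_sub_one hr.ne']
    field_simp
  have hode := hF.mul_deriv_add (one_sub_two_div_pos hη) hz
  refine (hprefactor.mul ((hF.1 _ hz).differentiableAt.hasDerivAt.comp r hargument)).congr_deriv ?_
  rw [Real.rpow_sub hr, Real.rpow_sub hr, Real.rpow_neg hr.le, Real.rpow_one, Real.rpow_ofNat]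
  set F := gauss2F1 1 (1 - 2 / η) (2 - 2 / η)
  have hden : r ^ η + c ≠ 0 := by positivity
  rw [Function.comp_apply]
  field_simp at hode ⊢
  rw [sub_neg_eq_add, eq_div_iff hden] at hode
  linear_combination -c * hode

theorem tendsto_radialExponent_atTop {η : ℝ} (hη : 2 < η) (c : ℝ) :
    Tendsto (radialExponent η c) atTop (𝓝 0) := by
  have hF := isGaussHypergeometric_gauss2F1_of_two_lt hη
  have hprefactor : Tendsto (fun d : ℝ => c * d ^ (2 - η) / (η - 2)) atTop (𝓝 0) := by
    simpa [neg_sub] using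
      ((tendsto_rpow_neg_atTop (sub_pos.2 hη)).const_mul c).div_const (η - 2)
  have hargument : Tendsto (fun d : ℝ => -c / d ^ η) atTop (𝓝 0) :=
    (tendsto_rpow_atTop (by linarith)).const_div_atTop (-c)
  simpa [radialExponent] using!
    hprefactor.mul ((hF.1 0 (mem_Iio.2 one_pos)).continuousAt.tendsto.comp hargument)

theorem integrableOn_Ioi_mul_div_one_add_mul_rpow {η c d : ℝ} (hη : 2 < η) (hc : 0 ≤ c)
    (hd : 0 < d) : IntegrableOn (fun r => r * (c * r ^ (-η) / (1 + c * r ^ (-η)))) (Ioi d) := by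
  have hderiv (r : ℝ) (hr : r ∈ Ici d) := (hasDerivAt_radialExponent hη hc (hd.trans_le hr)).neg
  simp only [neg_neg] at hderiv
  exact integrableOn_Ioi_deriv_of_nonneg' hderiv
    (fun r hr => have : 0 < r := hd.trans hr; by positivity) (tendsto_radialExponent_atTop hη c).neg

theorem integral_Ioi_mul_div_one_add_mul_rpow {η c d : ℝ} (hη : 2 < η) (hc : 0 ≤ c)
    (hd : 0 < d) :
    ∫ r in Ioi d, r * (c * r ^ (-η) / (1 + c * r ^ (-η))) = radialExponent η c d := by
  have hderiv (r : ℝ) (hr : r ∈ Ici d) := (hasDerivAt_radialExponent hη hc (hd.trans_le hr)).neg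
  simp only [neg_neg] at hderiv
  simpa using! integral_Ioi_of_hasDerivAt_of_tendsto' hderiv
    (integrableOn_Ioi_mul_div_one_add_mul_rpow hη hc hd) (tendsto_radialExponent_atTop hη c).neg

theorem radialExponent_nonneg {η c d : ℝ} (hη : 2 < η) (hc : 0 ≤ c) (hd : 0 < d) :
    0 ≤ radialExponent η c d := by
  rw [← integral_Ioi_mul_div_one_add_mul_rpow hη hc hd]
  exact setIntegral_nonneg measurableSet_Ioi fun r hr => have : 0 < r := hd.trans hr; by positivity

theorem lintegral_Ici_mul_div_one_add_mul_rpow {η c d : ℝ} (hη : 2 < η) (hc : 0 ≤ c)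
    (hd : 0 < d) :
    ∫⁻ r in Ici d, ENNReal.ofReal r * ENNReal.ofReal (c * r ^ (-η) / (1 + c * r ^ (-η))) =
      ENNReal.ofReal (radialExponent η c d) := by
  rw [← integral_Ioi_mul_div_one_add_mul_rpow hη hc hd, ofReal_integral_eq_lintegral_ofReal
    (integrableOn_Ioi_mul_div_one_add_mul_rpow hη hc hd), setLIntegral_congr Ioi_ae_eq_Ici.symm]
  · exact setLIntegral_congr_fun measurableSet_Ioi fun r hr =>
      (ENNReal.ofReal_mul (hd.trans hr).le).symm
  · exact ae_restrict_of_forall_mem measurableSet_Ioi fun r hr =>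
      have : 0 < r := hd.trans hr; by positivity

theorem continuousOn_radialExponent {η d : ℝ} (hη : 2 < η) (hd : 0 < d) :
    ContinuousOn (fun c => radialExponent η c d) (Ici 0) := by
  refine .mul (by fun_prop) ((isGaussHypergeometric_gauss2F1_of_two_lt hη).1.continuousOn.comp
    (by fun_prop) fun c hc => neg_div_rpow_lt_one hc hd)

end RadialIntegral

/-! ### Polar coordinates -/

section PolarCoordinates

theorem lintegral_norm_arg_div {v₀ : ℂ} (hv₀ : v₀ ≠ 0) (f : ℝ → ℝ → ℝ≥0∞) :
    ∫⁻ v : ℂ, f ‖v‖ (Complex.arg (v / v₀)) = ∫⁻ v : ℂ, f ‖v‖ (Complex.arg v) := by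
  have hrotate : ∀ w, rotation (Circle.exp (Complex.arg v₀)) w / v₀ = (‖v₀‖⁻¹ : ℝ) * w := by
    intro w
    rw [rotation_apply, Circle.coe_exp, div_eq_iff hv₀]
    nth_rewrite 3 [← Complex.norm_mul_exp_arg_mul_I v₀]
    push_cast
    field [show (‖v₀‖ : ℂ) ≠ 0 by exact_mod_cast norm_ne_zero_iff.2 hv₀]
  rw [← (rotation (Circle.exp (Complex.arg v₀))).measurePreserving.lintegral_comp_emb
    (rotation _).toHomeomorph.measurableEmbedding]
  simp_rw [LinearIsometryEquiv.norm_map, hrotate,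
    Complex.arg_real_mul _ (inv_pos.2 (norm_pos_iff.2 hv₀))]

theorem lintegral_norm_arg {f : ℝ → ℝ → ℝ≥0∞} (hf : Measurable (Function.uncurry f)) :
    ∫⁻ v : ℂ, f ‖v‖ (Complex.arg v) =
      ∫⁻ θ in Ioo (-Real.pi) Real.pi, ∫⁻ r in Ioi 0, ENNReal.ofReal r * f r θ := by
  have hpolar : ∀ p ∈ polarCoord.target, ENNReal.ofReal p.1 • f ‖Complex.polarCoord.symm p‖
      (Complex.arg (Complex.polarCoord.symm p)) = ENNReal.ofReal p.1 * f p.1 p.2 := by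
    rintro ⟨r, θ⟩ ⟨hr : 0 < r, hθ⟩
    rw [Complex.norm_polarCoord_symm, Complex.polarCoord_symm_apply, abs_of_pos hr,
      Complex.ofReal_cos, Complex.ofReal_sin,
      Complex.arg_mul_cos_add_sin_mul_I hr (Ioo_subset_Ioc_self hθ), smul_eq_mul]
  rw [← Complex.lintegral_comp_polarCoord_symm,
    setLIntegral_congr_fun polarCoord.open_target.measurableSet hpolar, polarCoord_target,
    Measure.volume_eq_prod, ← Measure.prod_restrict, lintegral_prod_symm]
  exact ((ENNReal.measurable_ofReal.comp measurable_fst).mul hf).aemeasurable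

theorem setLIntegral_norm_arg_div {v₀ : ℂ} (hv₀ : v₀ ≠ 0) {f : ℝ → ℝ → ℝ≥0∞}
    (hf : Measurable (Function.uncurry f)) {d : ℝ} (hd : 0 < d) :
    ∫⁻ v in {v : ℂ | d ≤ ‖v‖}, f ‖v‖ (Complex.arg (v / v₀)) =
      ∫⁻ θ in Ioo (-Real.pi) Real.pi, ∫⁻ r in Ici d, ENNReal.ofReal r * f r θ := by
  have hcut : Measurable (Function.uncurry fun r θ => (Ici d).indicator (f · θ) r) :=
    hf.indicator (measurable_fst measurableSet_Ici)
  have hradial (θ : ℝ) : ∫⁻ r in Ioi 0, ENNReal.ofReal r * (Ici d).indicator (f · θ) r =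
      ∫⁻ r in Ici d, ENNReal.ofReal r * f r θ := by
    simp_rw [← indicator_mul_right _ ENNReal.ofReal]
    rw [setLIntegral_indicator measurableSet_Ici,
      inter_eq_self_of_subset_left (Ici_subset_Ioi.2 hd)]
  rw [← lintegral_indicator (measurableSet_le measurable_const measurable_norm)]
  simp_rw [← hradial]
  rw [← lintegral_norm_arg hcut,
    ← lintegral_norm_arg_div hv₀ fun r θ => (Ici d).indicator (f · θ) r]
  rfl

theorem setLIntegral_Ioo_neg_pi_pi_ofReal {J : ℝ → ℝ} (hJ : Continuous J) (hJ0 : ∀ θ, 0 ≤ J θ)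
    (hJp : Function.Periodic J (2 * Real.pi)) :
    ∫⁻ θ in Ioo (-Real.pi) Real.pi, ENNReal.ofReal (J θ) =
      ENNReal.ofReal (∫ θ in (0 : ℝ)..(2 * Real.pi), J θ) := by
  have hperiod := hJp.intervalIntegral_add_eq 0 (-Real.pi)
  rw [zero_add, show -Real.pi + 2 * Real.pi = Real.pi by ring] at hperiod
  rw [hperiod, intervalIntegral.integral_of_le (by linarith [Real.pi_pos]),
    integral_Ioc_eq_integral_Ioo, ofReal_integral_eq_lintegral_ofReal
      (hJ.integrableOn_Icc.mono_set Ioo_subset_Icc_self) (.of_forall hJ0)]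

end PolarCoordinates

/-! ### The success probability -/

/-- The path gain `g v * ‖v‖ ^ (-η)` of an interferer at `v` times a factor `κ`, which will be the
decoding threshold divided by the path gain of the intended link. It vanishes at distances below
`d`, where devices do not interfere. -/
def scaledGain (κ η d : ℝ) (g : ℂ → ℝ) : ℂ → ℝ :=
  {v | d ≤ ‖v‖}.indicator fun v => κ * g v * ‖v‖ ^ (-η)

section Network

variable {Ω : Type*} {κ η d : ℝ} {g : ℂ → ℝ}

theorem scaledGain_nonneg (hκ : 0 ≤ κ) (hg : ∀ v, 0 ≤ g v) (v : ℂ) :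
    0 ≤ scaledGain κ η d g v :=
  indicator_nonneg (fun v _ => by have := hg v; positivity) v

theorem measurable_scaledGain (hg : Measurable g) : Measurable (scaledGain κ η d g) :=
  Measurable.indicator (by fun_prop) (measurableSet_le measurable_const measurable_norm)

theorem lintegral_scaledGain_div_one_add {G : ℝ → ℝ} (hG : Continuous G) (hG0 : ∀ θ, 0 ≤ G θ)
    (hGp : Function.Periodic G (2 * Real.pi)) (hκ : 0 ≤ κ) (hη : 2 < η) (hd : 0 < d) {v₀ : ℂ}
    (hv₀ : v₀ ≠ 0) :
    ∫⁻ v, ENNReal.ofReal (scaledGain κ η d (fun v => G (Complex.arg (v / v₀))) v /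
        (1 + scaledGain κ η d (fun v => G (Complex.arg (v / v₀))) v)) =
      ENNReal.ofReal (∫ θ in (0 : ℝ)..(2 * Real.pi), radialExponent η (κ * G θ) d) := by
  have hκG (θ : ℝ) : 0 ≤ κ * G θ := mul_nonneg hκ (hG0 θ)
  let f (r θ : ℝ) : ℝ≥0∞ := ENNReal.ofReal (κ * G θ * r ^ (-η) / (1 + κ * G θ * r ^ (-η)))
  have hf : Measurable (Function.uncurry f) := by
    have := hG.measurable
    unfold f Function.uncurry
    fun_prop
  have hcut (v : ℂ) : ENNReal.ofReal (scaledGain κ η d (fun v => G (Complex.arg (v / v₀))) v /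
      (1 + scaledGain κ η d (fun v => G (Complex.arg (v / v₀))) v)) =
      {v : ℂ | d ≤ ‖v‖}.indicator (fun v => f ‖v‖ (Complex.arg (v / v₀))) v := by
    by_cases hv : d ≤ ‖v‖ <;> simp [scaledGain, f, hv]
  simp_rw [hcut]
  rw [lintegral_indicator (measurableSet_le measurable_const measurable_norm),
    setLIntegral_norm_arg_div hv₀ hf hd]
  simp_rw [f, lintegral_Ici_mul_div_one_add_mul_rpow hη (hκG _) hd]
  exact setLIntegral_Ioo_neg_pi_pi_ofReal
    ((continuousOn_radialExponent hη hd).comp_continuous (by fun_prop) hκG)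
    (fun θ => radialExponent_nonneg hη (hκG θ) hd) (fun θ => by simp only [hGp θ])

theorem ofReal_mul_interference {P R : ℝ} (hP : 0 < P) (hκ : 0 ≤ κ) {GT GR : ℂ → ℝ}
    (hGT : ∀ v, 0 ≤ GT v) (hGR : ∀ v, 0 ≤ GR v) (X : ℕ → Ω → ℂ) (h : ℕ → Ω → ℝ) (ω : Ω) :
    ENNReal.ofReal (κ / P) * interference P η R GT GR X h ω =
      ∑' i, ENNReal.ofReal (scaledGain κ η (√3 * R / 2) (fun v => GT v * GR v) (X i ω)) *
        ENNReal.ofReal (h i ω) := by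
  rw [interference, ← ENNReal.tsum_mul_left]
  refine tsum_congr fun i => ?_
  by_cases hi : √3 * R / 2 ≤ ‖X i ω‖
  · have := hGT (X i ω)
    have := hGR (X i ω)
    rw [scaledGain, indicator_of_mem (by exact hi), indicator_of_mem (by exact hi),
      ← ENNReal.ofReal_mul (by positivity), ← ENNReal.ofReal_mul (by positivity)]
    field_simp
  · rw [scaledGain, indicator_of_notMem (by exact hi), indicator_of_notMem (by exact hi)]
    simp

theorem lt_sinr_iff {Ξ P η R σ r₀ g₀ : ℝ} (hΞ : 0 < Ξ) (hP : 0 < P) (hr₀ : 0 < r₀) (hg₀ : 0 < g₀)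
    (GT GR : ℂ → ℝ) (X : ℕ → Ω → ℂ) (h₀ : Ω → ℝ) (h : ℕ → Ω → ℝ) (ω : Ω) :
    ENNReal.ofReal Ξ < sinr P η R σ r₀ g₀ GT GR X h₀ h ω ↔
      ENNReal.ofReal (Ξ * r₀ ^ η / g₀ / P) *
        (ENNReal.ofReal (σ ^ 2) + interference P η R GT GR X h ω) < ENNReal.ofReal (h₀ ω) := by
  have hgain : 0 < P * g₀ * r₀ ^ (-η) := by positivity
  have hthreshold : Ξ = P * g₀ * r₀ ^ (-η) * (Ξ * r₀ ^ η / g₀ / P) := by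
    rw [Real.rpow_neg hr₀.le]
    field_simp
  rw [sinr, ENNReal.lt_div_iff_mul_lt (.inr ENNReal.ofReal_ne_top)
    (.inr (ENNReal.ofReal_pos.2 hΞ).ne'),
    show P * h₀ ω * g₀ * r₀ ^ (-η) = P * g₀ * r₀ ^ (-η) * h₀ ω by ring,
    ENNReal.ofReal_mul hgain.le]
  nth_rewrite 1 [hthreshold]
  rw [ENNReal.ofReal_mul hgain.le, mul_assoc, ENNReal.mul_lt_mul_iff_right
    (ENNReal.ofReal_pos.2 hgain).ne' ENNReal.ofReal_ne_top]

variable [MeasurableSpace Ω] {μ : Measure Ω} {lam : ℝ} {X : ℕ → Ω → ℂ} {h₀ : Ω → ℝ}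
  {h : ℕ → Ω → ℝ}

theorem PPPModel.hasLaw_gain (hM : PPPModel μ lam X h₀ h) (i : Option ℕ) :
    HasLaw (i.elim h₀ h) (expMeasure 1) μ := by
  rcases i with _ | i
  exacts [hM.law_h₀, hM.law_h i]

theorem PPPModel.measure_lt_sinr (hM : PPPModel μ lam X h₀ h) {Ξ P r₀ g₀ : ℝ} (η R σ : ℝ)
    (hΞ : 0 < Ξ) (hP : 0 < P) (hr₀ : 0 < r₀) (hg₀ : 0 < g₀) {GT GR : ℂ → ℝ} (hGTm : Measurable GT)
    (hGRm : Measurable GR) (hGT : ∀ v, 0 ≤ GT v) (hGR : ∀ v, 0 ≤ GR v) :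
    μ {ω | ENNReal.ofReal Ξ < sinr P η R σ r₀ g₀ GT GR X h₀ h ω} =
      expNeg (ENNReal.ofReal (Ξ * r₀ ^ η / g₀ / P * σ ^ 2) + ENNReal.ofReal lam * ∫⁻ v,
        ENNReal.ofReal (scaledGain (Ξ * r₀ ^ η / g₀) η (√3 * R / 2) (fun v => GT v * GR v) v /
          (1 + scaledGain (Ξ * r₀ ^ η / g₀) η (√3 * R / 2) (fun v => GT v * GR v) v))) := by
  have hκ : 0 ≤ Ξ * r₀ ^ η / g₀ := by positivity
  have : SigmaFinite (ENNReal.ofReal lam • (volume : Measure ℂ)) :=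
    inferInstanceAs (SigmaFinite (lam.toNNReal • (volume : Measure ℂ)))
  simp_rw [lt_sinr_iff hΞ hP hr₀ hg₀, mul_add, ofReal_mul_interference hP hκ hGT hGR]
  rw [← ENNReal.ofReal_mul (by positivity), ← smul_eq_mul (ENNReal.ofReal lam),
    ← lintegral_smul_measure]
  exact hM.poisson.measure_add_tsum_mul_lt hM.hasLaw_gain hM.indep_gains hM.indep_locations _
    (measurable_scaledGain (hGTm.mul hGRm))
    (scaledGain_nonneg hκ fun v => mul_nonneg (hGT v) (hGR v))

theorem PPPModel.successProb_eq_exp (hM : PPPModel μ lam X h₀ h) (hlam : 0 ≤ lam) {G : ℝ → ℝ}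
    (hG : Continuous G) (hG0 : ∀ θ, 0 ≤ G θ) (hGp : Function.Periodic G (2 * Real.pi))
    {P R g₀ Ξ : ℝ} (σ : ℝ) (hη : 2 < η) (hP : 0 < P) (hR : 0 < R) (hg₀ : 0 < g₀) (hΞ : 0 < Ξ)
    {v₀ : ℂ} (hv₀ : v₀ ≠ 0) :
    successProb μ G P η R σ g₀ Ξ v₀ X h₀ h =
      Real.exp (-(Ξ * ‖v₀‖ ^ η / g₀ / P * σ ^ 2) - lam * ∫ θ in (0 : ℝ)..(2 * Real.pi),
        radialExponent η (Ξ * ‖v₀‖ ^ η / g₀ * G θ) (√3 * R / 2)) := by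
  have hr₀ : 0 < ‖v₀‖ := norm_pos_iff.2 hv₀
  have hκ : 0 ≤ Ξ * ‖v₀‖ ^ η / g₀ := by positivity
  have hintegral : 0 ≤ ∫ θ in (0 : ℝ)..(2 * Real.pi),
      radialExponent η (Ξ * ‖v₀‖ ^ η / g₀ * G θ) (√3 * R / 2) :=
    intervalIntegral.integral_nonneg Real.two_pi_pos.le fun θ _ =>
      radialExponent_nonneg hη (mul_nonneg hκ (hG0 θ)) (by positivity)
  have hmeas : Measurable fun v : ℂ => G (Complex.arg (v / v₀)) :=
    hG.measurable.comp (by fun_prop)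
  rw [successProb, one_mul, measureReal_def, hM.measure_lt_sinr η R σ hΞ hP hr₀ hg₀
    measurable_const hmeas (fun _ => zero_le_one) fun _ => hG0 _]
  simp only [one_mul]
  rw [lintegral_scaledGain_div_one_add hG hG0 hGp hκ hη (by positivity) hv₀,
    ← ENNReal.ofReal_mul hlam, ← ENNReal.ofReal_add (by positivity) (by positivity),
    expNeg_ofReal (by positivity), ENNReal.toReal_ofReal (Real.exp_nonneg _), neg_add_rev]
  ring_nf

end Network

section Parameters

theorem continuous_antennaGain (b : ℝ) (n : ℕ) : Continuous (antennaGain b n) := by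
  unfold antennaGain
  fun_prop

theorem antennaGain_nonneg {b : ℝ} (hb0 : 0 ≤ b) (hb1 : b ≤ 1) (n : ℕ) (θ : ℝ) :
    0 ≤ antennaGain b n θ := by
  unfold antennaGain
  nlinarith [Real.neg_one_le_cos (n * θ)]

theorem periodic_antennaGain (b : ℝ) (n : ℕ) :
    Function.Periodic (antennaGain b n) (2 * Real.pi) := fun θ => by
  rw [antennaGain, mul_add, Real.cos_add_nat_mul_two_pi, antennaGain]

theorem antennaGain_zero (b : ℝ) (n : ℕ) : antennaGain b n 0 = 1 + b := by
  simp [antennaGain]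

theorem sinrThreshold_pos {L ζ W Ts : ℝ} {m : ℕ} (hL : 0 < L) (hζ : 0 < ζ) (hW : 0 < W)
    (hTs : 0 < Ts) (hm : 0 < m) : 0 < sinrThreshold L ζ W Ts m :=
  sub_pos.2 (Real.one_lt_rpow one_lt_two (by positivity))

theorem activeDensity_nonneg {Δx Δy : ℝ} (hΔx : 0 ≤ Δx) (hΔy : 0 ≤ Δy) (NG : ℕ) :
    0 ≤ activeDensity Δx Δy NG := by
  unfold activeDensity
  positivity

theorem activeDensity_mul_div (Δx Δy : ℝ) (NG : ℕ) (a g k : ℝ) :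
    activeDensity Δx Δy NG * (a / (g * k)) = a / (g * Δx * Δy * NG * k) := by
  rw [activeDensity]
  ring

end Parameters

end

end IoTNetwork

theorem corollary3_general {Ω : Type*} [MeasurableSpace Ω] {μ : Measure Ω} {lam : ℝ}
    {X : ℕ → Ω → ℂ} {h₀ : Ω → ℝ} {h : ℕ → Ω → ℝ} (hmodel : PPPModel μ lam X h₀ h)
    (hlam : 0 ≤ lam) {G : ℝ → ℝ} (hG : Continuous G) (hG0 : ∀ θ, 0 ≤ G θ)
    (hGp : Function.Periodic G (2 * Real.pi)) {R η P g₀ Ξ : ℝ} (σ : ℝ) (hR : 0 < R) (hη : 2 < η)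
    (hP : 0 < P) (hg₀ : 0 < g₀) (hΞ : 0 < Ξ) {v₀ : ℂ} (hv₀ : v₀ ≠ 0) :
    successProb μ G P η R σ g₀ Ξ v₀ X h₀ h =
      Real.exp
        (-(Ξ * ‖v₀‖ ^ η * σ ^ 2 / (g₀ * P)) -
          ∫ θ in (0 : ℝ)..(2 * Real.pi),
            lam * (Ξ * ‖v₀‖ ^ η * G θ * (√3 * R / 2) ^ (2 - η) / (g₀ * (η - 2))) *
              gauss2F1 1 (1 - 2 / η) (2 - 2 / η)
                (-(Ξ * ‖v₀‖ ^ η * G θ) / (g₀ * (√3 * R / 2) ^ η))) := by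
  rw [hmodel.successProb_eq_exp hlam hG hG0 hGp σ hη hP hR hg₀ hΞ hv₀,
    ← intervalIntegral.integral_const_mul]
  congr 2
  · field_simp
  · refine intervalIntegral.integral_congr fun θ _ => ?_
    simp only [radialExponent, mul_assoc]
    congr 2
    · field [sub_pos.2 hη]
    · field_simp

theorem corollary3 {Ω : Type*} [MeasurableSpace Ω] (μ : Measure Ω) [IsProbabilityMeasure μ]
    -- geometry of the network, path loss, transmission power, noise
    (Δx Δy R η P σ : ℝ) (NG : ℕ)
    (hΔx : 0 < Δx) (hΔy : 0 < Δy) (hR : 0 < R) (hNG : 0 < NG) (hη : 2 < η) (hP : 0 < P)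
    -- antenna pattern
    (b : ℝ) (n : ℕ) (hb0 : 0 ≤ b) (hb1 : b ≤ 1)
    -- packet size, rate parameters, number of segments
    (L ζ W Ts : ℝ) (m : ℕ) (hL : 0 < L) (hζ0 : 0 < ζ) (hζ1 : ζ ≤ 1) (hW : 0 < W) (hTs : 0 < Ts)
    (hm : 0 < m)
    -- location of the intended device
    (v₀ : ℂ) (hv₀ : v₀ ≠ 0)
    -- locations of the devices and fading gains
    (X : ℕ → Ω → ℂ) (h₀ : Ω → ℝ) (h : ℕ → Ω → ℝ)
    (hmodel : PPPModel μ (activeDensity Δx Δy NG) X h₀ h) :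
    -- receive gain of the intended link equal to 2
    successProb μ (antennaGain b n) P η R σ 2 (sinrThreshold L ζ W Ts m) v₀ X h₀ h =
      Real.exp
        (-(sinrThreshold L ζ W Ts m * ‖v₀‖ ^ η * σ ^ 2 / (2 * P)) -
          ∫ θ in (0 : ℝ)..(2 * Real.pi),
            sinrThreshold L ζ W Ts m * ‖v₀‖ ^ η * antennaGain b n θ * (√3 * R / 2) ^ (2 - η) /
                (2 * Δx * Δy * NG * (η - 2)) *
              gauss2F1 1 (1 - 2 / η) (2 - 2 / η)
                (-(sinrThreshold L ζ W Ts m * ‖v₀‖ ^ η * antennaGain b n θ) /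
                  (2 * (√3 * R / 2) ^ η))) ∧
    -- receive gain of the intended link equal to `G(0) = 1 + b` (which is 2 for `b = 1`)
    successProb μ (antennaGain b n) P η R σ (antennaGain b n 0) (sinrThreshold L ζ W Ts m)
        v₀ X h₀ h =
      Real.exp
        (-(sinrThreshold L ζ W Ts m * ‖v₀‖ ^ η * σ ^ 2 / ((1 + b) * P)) -
          ∫ θ in (0 : ℝ)..(2 * Real.pi),
            sinrThreshold L ζ W Ts m * ‖v₀‖ ^ η * antennaGain b n θ * (√3 * R / 2) ^ (2 - η) /
                ((1 + b) * Δx * Δy * NG * (η - 2)) *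
              gauss2F1 1 (1 - 2 / η) (2 - 2 / η)
                (-(sinrThreshold L ζ W Ts m * ‖v₀‖ ^ η * antennaGain b n θ) /
                  ((1 + b) * (√3 * R / 2) ^ η))) := by
  have key (g₀ : ℝ) (hg₀ : 0 < g₀) := corollary3_general hmodel
    (activeDensity_nonneg hΔx.le hΔy.le NG) (continuous_antennaGain b n)
    (antennaGain_nonneg hb0 hb1 n) (periodic_antennaGain b n) σ hR hη hP hg₀
    (sinrThreshold_pos hL hζ0 hW hTs hm) hv₀
  simp only [activeDensity_mul_div] at key
  exact ⟨key 2 two_pos, by rw [antennaGain_zero]; exact key (1 + b) (by positivity)⟩
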